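/- Regard three-qubit operators as $8\times 8$ complex matrices, with rows and columns indexed by $(i,j,k)\in\{0,1\}^3$ in lexicographic order. A three-qubit state $\varrho$ is a nonzero positive semi-definite $8\times 8$ matrix (not necessarily of trace one); it is separable if it is a nonnegative multiple of a convex combination of pure product states $|x\rangle\langle x|\otimes|y\rangle\langle y|\otimes|z\rangle\langle z|$ with unit vectors $x,y,z\in\mathbb C^2$. The $\mathsf X$-part of $\varrho$ is obtained by replacing by $0$ all entries that are neither on the diagonal nor on the anti-diagonal. For $a,b\in\mathbb R^4$ and $c\in\mathbb C^4$, $X(a,b,c)$ is the self-adjoint $8\times 8$ matrix with diagonal $(a_1,a_2,a_3,a_4,b_4,b_3,b_2,b_1)$, with anti-diagonal $(c_1,c_2,c_3,c_4,\bar c_4,\bar c_3,\bar c_2,\bar c_1)$ read from the top row to the bottom row, and with zeros elsewhere. Let $\varrho$ be a three-qubit state with $\mathsf X$-part $X(a,b,c)$, and put $$\Delta_\varrho=\min\Big\{\sqrt{a_1b_1},\ \sqrt{a_2b_2},\ \sqrt{a_3b_3},\ \sqrt{a_4b_4},\ \sqrt[4]{a_1b_2b_3a_4},\ \sqrt[4]{b_1a_2a_3b_4}\Big\}.$$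 Write $c_j=|c_j|e^{\mathrm i\theta_j}$ with $\theta_j\in\mathbb R$ (if $c_j=0$, any $\theta_j$ may be chosen), and let $\phi_c=(\theta_1+\theta_4)-(\theta_2+\theta_3)$. Let $\{i_1,i_2\}\cup\{i_3,i_4\}=\{1,2,3,4\}$ be any partition into two pairs, and let $$m_1=\frac{|c_{i_1}|+|c_{i_2}|}2,\qquad m_2=\frac{|c_{i_3}|+|c_{i_4}|}2 .$$ If $\varrho$ is separable, then $$\Delta_\varrho\ \ge\ \frac{\sqrt2\,m_1m_2}{\sqrt{m_1^2+m_2^2}}\,\sqrt{1+|\sin(\phi_c/2)|},$$ where the right-hand side is read as $0$ if $m_1=m_2=0$. -/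

import Mathlib

open scoped Kronecker ComplexOrder

/-- The index set of three qubits, identified with `{0, …, 7}` in lexicographic order:
`(i, j, k) ↦ 4 i + 2 j + k`. -/
def lexEquiv : Fin 2 × Fin 2 × Fin 2 ≃ Fin 8 :=
  ((Equiv.refl (Fin 2)).prodCongr (finProdFinEquiv (m := 2) (n := 2))).trans
    (finProdFinEquiv (m := 2) (n := 4))

theorem lexEquiv_apply (i j k : Fin 2) :
    (lexEquiv (i, j, k)).val = 4 * i.val + 2 * j.val + k.val := by
  revert i j k
  decide

/-- A three qubit state, not necessarily normalized: a nonzero positive semi-definite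
`8 × 8` matrix. -/
def IsThreeQubitState (ρ : Matrix (Fin 8) (Fin 8) ℂ) : Prop :=
  ρ.PosSemidef ∧ ρ ≠ 0

/-- The pure one qubit states `|x⟩⟨x|`, where `x` is a unit vector of `ℂ²`. -/
def pureQubitStates : Set (Matrix (Fin 2) (Fin 2) ℂ) :=
  {P | ∃ x : Fin 2 → ℂ, star x ⬝ᵥ x = 1 ∧ P = Matrix.vecMulVec x (star x)}

/-- The pure product states `|x⟩⟨x| ⊗ |y⟩⟨y| ⊗ |z⟩⟨z|` of three qubits, as `8 × 8` matrices
with the lexicographic order of indices. -/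
def pureProductStates : Set (Matrix (Fin 8) (Fin 8) ℂ) :=
  {ρ | ∃ P ∈ pureQubitStates, ∃ Q ∈ pureQubitStates, ∃ R ∈ pureQubitStates,
    ρ = Matrix.reindex lexEquiv lexEquiv (P ⊗ₖ (Q ⊗ₖ R))}

/-- Separability: `ρ` is, up to normalization, a convex combination of pure product states.
As pure product states have trace one, the factor `t` is the trace of `ρ`; for a normalized
state it is `1`. -/
def IsSeparableState (ρ : Matrix (Fin 8) (Fin 8) ℂ) : Prop :=
  ∃ t : ℝ, 0 ≤ t ∧ ∃ σ ∈ convexHull ℝ pureProductStates, ρ = t • σ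

/-- The self-adjoint `X`-shaped matrix `X(a, b, c)`. -/
def xMatrix (a b : Fin 4 → ℝ) (c : Fin 4 → ℂ) : Matrix (Fin 8) (Fin 8) ℂ :=
  !![(a 0 : ℂ), 0, 0, 0, 0, 0, 0, c 0;
     0, (a 1 : ℂ), 0, 0, 0, 0, c 1, 0;
     0, 0, (a 2 : ℂ), 0, 0, c 2, 0, 0;
     0, 0, 0, (a 3 : ℂ), c 3, 0, 0, 0;
     0, 0, 0, star (c 3), (b 3 : ℂ), 0, 0, 0;
     0, 0, star (c 2), 0, 0, (b 2 : ℂ), 0, 0;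
     0, star (c 1), 0, 0, 0, 0, (b 1 : ℂ), 0;
     star (c 0), 0, 0, 0, 0, 0, 0, (b 0 : ℂ)]

/-- The `X`-part of a matrix: all entries off the diagonal and the anti-diagonal are replaced
by zero. -/
def xPart (ρ : Matrix (Fin 8) (Fin 8) ℂ) : Matrix (Fin 8) (Fin 8) ℂ :=
  Matrix.of fun k l => if l = k ∨ l = Fin.rev k then ρ k l else 0

/-- `Δ = min {√(aᵢ bᵢ) (i = 1, 2, 3, 4), ⁴√(a₁ b₂ b₃ a₄), ⁴√(b₁ a₂ a₃ b₄)}`. -/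
noncomputable def xDelta (a b : Fin 4 → ℝ) : ℝ :=
  min (Finset.univ.inf' Finset.univ_nonempty fun i => Real.sqrt (a i * b i))
    (min ((a 0 * b 1 * b 2 * a 3) ^ (1 / 4 : ℝ)) ((b 0 * a 1 * a 2 * b 3) ^ (1 / 4 : ℝ)))

/-- `θ` is a choice of phases of the entries of `c`, that is `cᵢ = |cᵢ| exp(i θᵢ)`. The phase
of a nonzero entry is determined modulo `2π`, the phase of a zero entry is arbitrary. -/
def IsPhases (c : Fin 4 → ℂ) (θ : Fin 4 → ℝ) : Prop :=
  ∀ i, c i = (‖c i‖ : ℂ) * Complex.exp ((θ i : ℂ) * Complex.I)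

/-- The phase difference `φ = (θ₁ + θ₄) - (θ₂ + θ₃)`. -/
def phaseDifference (θ : Fin 4 → ℝ) : ℝ :=
  (θ 0 + θ 3) - (θ 1 + θ 2)

/-! For a pure product state every geometric mean in `xDelta` equals the same `r`, and the upper
anti-diagonal is `r • u` with `u` unimodular and `u 0 * u 3 = u 1 * u 2`. Geometric means are
superadditive, so for separable states the summed `r` stays below `xDelta`, while the anti-diagonal
stays in `r` times the absolutely convex hull of such `u`. `AntidiagBound` records the latter
dually, by testing against linear functionals `w`.

The chosen `w` has weights `p` and `q` on the two pairs, and phases opposite to those of `c` up to a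
twist by `±δ`. The twist turns the relation on `u` into `e 0 * e 3 = -(e 1 * e 2)`, under which `w`
is at most `2 * √(p ^ 2 + q ^ 2)`; its value on `c` has real part `cos δ * 2 * (p ^ 2 + q ^ 2)`.
With `p`, `q` the pair means this bounds `r` below (`AntidiagBound.pair_means_le`), and AM-GM gives
the stated quotient. -/

/-- Phases `u` of the anti-diagonal of a pure product state. -/
def IsProductPhase (u : Fin 4 → ℂ) : Prop :=
  (∀ i, ‖u i‖ = 1) ∧ u 0 * u 3 = u 1 * u 2

/-- The upper half of the anti-diagonal. -/
def upperAntidiag (σ : Matrix (Fin 8) (Fin 8) ℂ) : Fin 4 → ℂ :=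
  ![σ 0 7, σ 1 6, σ 2 5, σ 3 4]

/-- The real part of the diagonal. -/
def diagRe (σ : Matrix (Fin 8) (Fin 8) ℂ) (i : Fin 8) : ℝ := (σ i i).re

/-- `r` is a common lower bound for the geometric means of diagonal entries, and an upper bound
for the gauge of the anti-diagonal with respect to the product phases. -/
structure AntidiagBound (σ : Matrix (Fin 8) (Fin 8) ℂ) (r : ℝ) : Prop where
  nonneg : 0 ≤ r
  diag_nonneg : ∀ i, 0 ≤ diagRe σ i
  sq_le : ∀ i, r ^ 2 ≤ diagRe σ i * diagRe σ (Fin.rev i)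
  even_le : r ^ 4 ≤ diagRe σ 0 * diagRe σ 6 * (diagRe σ 5 * diagRe σ 3)
  odd_le : r ^ 4 ≤ diagRe σ 7 * diagRe σ 1 * (diagRe σ 2 * diagRe σ 4)
  dual_le : ∀ (w : Fin 4 → ℂ) (K : ℝ), (∀ u, IsProductPhase u → ‖∑ i, w i * u i‖ ≤ K) →
    ‖∑ i, w i * upperAntidiag σ i‖ ≤ K * r

/-! ### Stability of the bound under conic combinations -/

theorem add_sq_le_mul_add {a b a' b' r r' : ℝ} (ha : 0 ≤ a) (hb : 0 ≤ b) (ha' : 0 ≤ a')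
    (hb' : 0 ≤ b') (h : r ^ 2 ≤ a * b) (h' : r' ^ 2 ≤ a' * b') :
    (r + r') ^ 2 ≤ (a + a') * (b + b') := by
  have h1 : (r * r') ^ 2 ≤ (a * b') * (a' * b) := by
    calc (r * r') ^ 2 = r ^ 2 * r' ^ 2 := by ring
      _ ≤ (a * b) * (a' * b') := mul_le_mul h h' (sq_nonneg _) (mul_nonneg ha hb)
      _ = _ := by ring
  have h2 : 2 * (r * r') ≤ a * b' + a' * b := by
    apply abs_le_of_sq_le_sq' _ (by positivity) |>.2
    nlinarith [sq_nonneg (a * b' - a' * b)]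
  nlinarith

/-- Apply the two-factor inequality to each pair of factors, then to the resulting square roots. -/
theorem add_pow_four_le_mul_add {a b c d a' b' c' d' r r' : ℝ} (ha : 0 ≤ a) (hb : 0 ≤ b)
    (hc : 0 ≤ c) (hd : 0 ≤ d) (ha' : 0 ≤ a') (hb' : 0 ≤ b') (hc' : 0 ≤ c') (hd' : 0 ≤ d')
    (h : r ^ 4 ≤ a * b * (c * d))
    (h' : r' ^ 4 ≤ a' * b' * (c' * d')) :
    (r + r') ^ 4 ≤ (a + a') * (b + b') * ((c + c') * (d + d')) := by
  have key : ∀ {a b c d r : ℝ}, 0 ≤ a → 0 ≤ b → r ^ 4 ≤ a * b * (c * d) →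
      r ^ 2 ≤ √(a * b) * √(c * d) := by
    intro a b c d r ha hb h
    rw [← Real.sqrt_mul (mul_nonneg ha hb)]
    exact Real.le_sqrt_of_sq_le (by linarith [show (r ^ 2) ^ 2 = r ^ 4 by ring])
  have h1 := add_sq_le_mul_add (Real.sqrt_nonneg _) (Real.sqrt_nonneg _) (Real.sqrt_nonneg _)
    (Real.sqrt_nonneg _) (key ha hb h) (key ha' hb' h')
  have h2 := add_sq_le_mul_add ha hb ha' hb'
    (Real.sq_sqrt (mul_nonneg ha hb)).le (Real.sq_sqrt (mul_nonneg ha' hb')).le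
  have h3 := add_sq_le_mul_add hc hd hc' hd'
    (Real.sq_sqrt (mul_nonneg hc hd)).le (Real.sq_sqrt (mul_nonneg hc' hd')).le
  calc (r + r') ^ 4 = ((r + r') ^ 2) ^ 2 := by ring
    _ ≤ ((√(a * b) + √(a' * b')) * (√(c * d) + √(c' * d'))) ^ 2 := by gcongr
    _ = (√(a * b) + √(a' * b')) ^ 2 * (√(c * d) + √(c' * d')) ^ 2 := by ring
    _ ≤ _ := by gcongr

theorem AntidiagBound.add {σ τ : Matrix (Fin 8) (Fin 8) ℂ} {r s : ℝ}
    (hσ : AntidiagBound σ r) (hτ : AntidiagBound τ s) : AntidiagBound (σ + τ) (r + s) := by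
  have hd : ∀ i, diagRe (σ + τ) i = diagRe σ i + diagRe τ i := fun i => by simp [diagRe]
  refine ⟨add_nonneg hσ.nonneg hτ.nonneg, fun i => ?_, fun i => ?_, ?_, ?_, fun w K h => ?_⟩
  · rw [hd]
    exact add_nonneg (hσ.diag_nonneg i) (hτ.diag_nonneg i)
  · rw [hd, hd]
    exact add_sq_le_mul_add (hσ.diag_nonneg _) (hσ.diag_nonneg _) (hτ.diag_nonneg _)
      (hτ.diag_nonneg _) (hσ.sq_le i) (hτ.sq_le i)
  · simp only [hd]
    exact add_pow_four_le_mul_add (hσ.diag_nonneg _) (hσ.diag_nonneg _) (hσ.diag_nonneg _)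
      (hσ.diag_nonneg _) (hτ.diag_nonneg _) (hτ.diag_nonneg _) (hτ.diag_nonneg _)
      (hτ.diag_nonneg _) hσ.even_le hτ.even_le
  · simp only [hd]
    exact add_pow_four_le_mul_add (hσ.diag_nonneg _) (hσ.diag_nonneg _) (hσ.diag_nonneg _)
      (hσ.diag_nonneg _) (hτ.diag_nonneg _) (hτ.diag_nonneg _) (hτ.diag_nonneg _)
      (hτ.diag_nonneg _) hσ.odd_le hτ.odd_le
  · have he : ∑ i, w i * upperAntidiag (σ + τ) i =
        ∑ i, w i * upperAntidiag σ i + ∑ i, w i * upperAntidiag τ i := by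
      simp only [Fin.sum_univ_four, upperAntidiag, Matrix.add_apply, Matrix.cons_val]
      ring
    rw [he, mul_add]
    exact (norm_add_le _ _).trans (add_le_add (hσ.dual_le w K h) (hτ.dual_le w K h))

theorem AntidiagBound.smul {σ : Matrix (Fin 8) (Fin 8) ℂ} {r t : ℝ} (ht : 0 ≤ t)
    (hσ : AntidiagBound σ r) : AntidiagBound (t • σ) (t * r) := by
  have hd : ∀ i, diagRe (t • σ) i = t * diagRe σ i := fun i => by simp [diagRe]
  refine ⟨mul_nonneg ht hσ.nonneg, fun i => ?_, fun i => ?_, ?_, ?_, fun w K h => ?_⟩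
  · rw [hd]
    exact mul_nonneg ht (hσ.diag_nonneg i)
  · rw [hd, hd]
    linarith [mul_le_mul_of_nonneg_left (hσ.sq_le i) (pow_nonneg ht 2)]
  · simp only [hd]
    linarith [mul_le_mul_of_nonneg_left hσ.even_le (pow_nonneg ht 4)]
  · simp only [hd]
    linarith [mul_le_mul_of_nonneg_left hσ.odd_le (pow_nonneg ht 4)]
  · have he : ∑ i, w i * upperAntidiag (t • σ) i = (t : ℂ) * ∑ i, w i * upperAntidiag σ i := by
      simp only [Fin.sum_univ_four, upperAntidiag, Matrix.smul_apply, Matrix.cons_val,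
        Complex.real_smul]
      ring
    rw [he, norm_mul, Complex.norm_real, Real.norm_of_nonneg ht]
    linarith [mul_le_mul_of_nonneg_left (hσ.dual_le w K h) ht]

/-! ### Pure product states -/

theorem reindex_lexEquiv_kronecker_vecMulVec (x y z : Fin 2 → ℂ) (i j k i' j' k' : Fin 2) :
    Matrix.reindex lexEquiv lexEquiv (Matrix.vecMulVec x (star x) ⊗ₖ
      (Matrix.vecMulVec y (star y) ⊗ₖ Matrix.vecMulVec z (star z)))
      (lexEquiv (i, j, k)) (lexEquiv (i', j', k')) =
    (x i * star (x i')) * ((y j * star (y j')) * (z k * star (z k'))) := by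
  simp [Matrix.reindex_apply, Matrix.vecMulVec_apply]

theorem exists_phase (α : ℂ) : ∃ u : ℂ, ‖u‖ = 1 ∧ α = (‖α‖ : ℂ) * u :=
  ⟨Complex.exp (α.arg * Complex.I), Complex.norm_exp_ofReal_mul_I _,
    (Complex.norm_mul_exp_arg_mul_I α).symm⟩

theorem mul_conj_of_norm_eq_one {u : ℂ} (hu : ‖u‖ = 1) : u * star u = 1 := by
  rw [Complex.star_def, Complex.mul_conj, Complex.normSq_eq_norm_sq, hu]
  norm_num

theorem antidiagBound_of_pureProduct (x y z : Fin 2 → ℂ) :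
    AntidiagBound (Matrix.reindex lexEquiv lexEquiv (Matrix.vecMulVec x (star x) ⊗ₖ
      (Matrix.vecMulVec y (star y) ⊗ₖ Matrix.vecMulVec z (star z))))
      (‖x 0‖ * ‖x 1‖ * (‖y 0‖ * ‖y 1‖) * (‖z 0‖ * ‖z 1‖)) := by
  have e0 : (0 : Fin 8) = lexEquiv (0, 0, 0) := by decide
  have e1 : (1 : Fin 8) = lexEquiv (0, 0, 1) := by decide
  have e2 : (2 : Fin 8) = lexEquiv (0, 1, 0) := by decide
  have e3 : (3 : Fin 8) = lexEquiv (0, 1, 1) := by decide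
  have e4 : (4 : Fin 8) = lexEquiv (1, 0, 0) := by decide
  have e5 : (5 : Fin 8) = lexEquiv (1, 0, 1) := by decide
  have e6 : (6 : Fin 8) = lexEquiv (1, 1, 0) := by decide
  have e7 : (7 : Fin 8) = lexEquiv (1, 1, 1) := by decide
  have entry := reindex_lexEquiv_kronecker_vecMulVec x y z
  generalize Matrix.reindex lexEquiv lexEquiv (Matrix.vecMulVec x (star x) ⊗ₖ
      (Matrix.vecMulVec y (star y) ⊗ₖ Matrix.vecMulVec z (star z))) = σ at entry
  have hd : ∀ i j k, diagRe σ (lexEquiv (i, j, k)) = (‖x i‖ * ‖y j‖ * ‖z k‖) ^ 2 := by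
    intro i j k
    have : ∀ v : ℂ, v * star v = ((‖v‖ ^ 2 : ℝ) : ℂ) := fun v => by
      rw [Complex.star_def, Complex.mul_conj, Complex.normSq_eq_norm_sq]
    rw [diagRe, entry, this, this, this, ← Complex.ofReal_mul, ← Complex.ofReal_mul,
      Complex.ofReal_re]
    ring
  have hrev : ∀ i j k, Fin.rev (lexEquiv (i, j, k)) =
      lexEquiv (Fin.rev i, Fin.rev j, Fin.rev k) := by decide
  have hmul : ∀ (v : Fin 2 → ℂ) i, ‖v i‖ * ‖v (Fin.rev i)‖ = ‖v 0‖ * ‖v 1‖ := by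
    intro v i
    fin_cases i
    · rfl
    · exact mul_comm _ _
  refine ⟨by positivity, fun i => ?_, fun i => ?_, ?_, ?_, fun w K h => ?_⟩
  · obtain ⟨⟨i, j, k⟩, rfl⟩ := lexEquiv.surjective i
    rw [hd]
    positivity
  · obtain ⟨⟨i, j, k⟩, rfl⟩ := lexEquiv.surjective i
    rw [hrev, hd, hd, ← hmul x i, ← hmul y j, ← hmul z k]
    exact le_of_eq (by ring)
  -- Among the even-parity triples 000, 110, 101, 011 each bit takes each value twice, so equality
  -- holds; the odd-parity case is alike.
  · rw [e0, e6, e5, e3, hd, hd, hd, hd]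
    exact le_of_eq (by ring)
  · rw [e7, e1, e2, e4, hd, hd, hd, hd]
    exact le_of_eq (by ring)
  · obtain ⟨A, hA, hxA⟩ := exists_phase (x 0 * star (x 1))
    obtain ⟨B, hB, hyB⟩ := exists_phase (y 0 * star (y 1))
    obtain ⟨C, hC, hzC⟩ := exists_phase (z 0 * star (z 1))
    have hyB' : y 1 * star (y 0) = (‖y 0 * star (y 1)‖ : ℂ) * star B := by
      simpa [mul_comm] using congrArg star hyB
    have hzC' : z 1 * star (z 0) = (‖z 0 * star (z 1)‖ : ℂ) * star C := by
      simpa [mul_comm] using congrArg star hzC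
    have hBB := mul_conj_of_norm_eq_one hB
    have hCC := mul_conj_of_norm_eq_one hC
    -- Flipping the second or third bit conjugates `B` or `C`; both products in the relation equal
    -- `A ^ 2`.
    have hu : IsProductPhase
        ![A * (B * C), A * (B * star C), A * (star B * C), A * (star B * star C)] := by
      constructor
      · intro i
        fin_cases i <;> simp [hA, hB, hC]
      · simp only [Matrix.cons_val]
        ring
    have he : ∑ i, w i * upperAntidiag σ i =
        ((‖x 0‖ * ‖x 1‖ * (‖y 0‖ * ‖y 1‖) * (‖z 0‖ * ‖z 1‖) : ℝ) : ℂ) *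
        ∑ i, w i *
          ![A * (B * C), A * (B * star C), A * (star B * C), A * (star B * star C)] i := by
      have n : ∀ v : Fin 2 → ℂ, ‖v 0 * star (v 1)‖ = ‖v 0‖ * ‖v 1‖ := fun v => by
        rw [norm_mul, norm_star]
      rw [n] at hxA hyB hzC hyB' hzC'
      simp only [Fin.sum_univ_four, upperAntidiag, Matrix.cons_val]
      rw [e0, e1, e2, e3, e4, e5, e6, e7]
      simp only [entry, hxA, hyB, hzC, hyB', hzC']
      push_cast
      ring
    rw [he, norm_mul, Complex.norm_real, Real.norm_of_nonneg (by positivity), mul_comm]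
    exact mul_le_mul_of_nonneg_right (h _ hu) (by positivity)

theorem IsSeparableState.exists_antidiagBound {ρ : Matrix (Fin 8) (Fin 8) ℂ}
    (h : IsSeparableState ρ) : ∃ r, AntidiagBound ρ r := by
  obtain ⟨t, ht, σ, hσ, rfl⟩ := h
  have hconv : Convex ℝ {σ : Matrix (Fin 8) (Fin 8) ℂ | ∃ r, AntidiagBound σ r} := by
    rintro σ ⟨r, hr⟩ τ ⟨s, hs⟩ p q hp hq -
    exact ⟨_, (hr.smul hp).add (hs.smul hq)⟩
  have hsub : pureProductStates ⊆ {σ : Matrix (Fin 8) (Fin 8) ℂ | ∃ r, AntidiagBound σ r} := by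
    rintro _ ⟨_, ⟨x, -, rfl⟩, _, ⟨y, -, rfl⟩, _, ⟨z, -, rfl⟩, rfl⟩
    exact ⟨_, antidiagBound_of_pureProduct x y z⟩
  obtain ⟨r, hr⟩ := convexHull_min hsub hconv hσ
  exact ⟨_, hr.smul ht⟩

/-! ### Bounds on twisted unimodular quadruples -/

/-- The relation makes the cross terms of `‖e₀ + e₁‖ ^ 2` and `‖e₂ + e₃‖ ^ 2` cancel, so these add
up to 4; Cauchy-Schwarz finishes. -/
theorem norm_combination_le_of_adjacent (p q : ℝ) {e₀ e₁ e₂ e₃ : ℂ} (h₀ : ‖e₀‖ = 1)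
    (h₁ : ‖e₁‖ = 1) (h₂ : ‖e₂‖ = 1) (h₃ : ‖e₃‖ = 1) (he : e₀ * e₃ = -(e₁ * e₂)) :
    ‖(p : ℂ) * (e₀ + e₁) + (q : ℂ) * (e₂ + e₃)‖ ≤ 2 * √(p ^ 2 + q ^ 2) := by
  have hc : e₀ * star e₁ = -(e₂ * star e₃) := by
    linear_combination star e₁ * star e₃ * he -
      e₀ * star e₁ * mul_conj_of_norm_eq_one h₃ - e₂ * star e₃ * mul_conj_of_norm_eq_one h₁
  have hre : (e₀ * star e₁).re = -(e₂ * star e₃).re := by rw [hc, Complex.neg_re]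
  have hsum : ‖e₀ + e₁‖ ^ 2 + ‖e₂ + e₃‖ ^ 2 = 4 := by
    rw [← Complex.normSq_eq_norm_sq, ← Complex.normSq_eq_norm_sq, Complex.normSq_add,
      Complex.normSq_add]
    simp only [Complex.normSq_eq_norm_sq, h₀, h₁, h₂, h₃, Complex.star_def] at hre ⊢
    linarith
  refine (norm_add_le _ _).trans ?_
  rw [norm_mul, norm_mul, Complex.norm_real, Complex.norm_real, Real.norm_eq_abs,
    Real.norm_eq_abs]
  apply abs_le_of_sq_le_sq' _ (by positivity) |>.2
  rw [mul_pow, Real.sq_sqrt (by positivity)]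
  have hp := sq_abs p
  have hq := sq_abs q
  nlinarith [sq_nonneg (|p| * ‖e₂ + e₃‖ - |q| * ‖e₀ + e₁‖)]

/-- The two sums are orthogonal as vectors of the real plane, and each has length at most 2. -/
theorem norm_combination_le_of_opposite (p q : ℝ) {e₀ e₁ e₂ e₃ : ℂ} (h₀ : ‖e₀‖ = 1)
    (h₁ : ‖e₁‖ = 1) (h₂ : ‖e₂‖ = 1) (h₃ : ‖e₃‖ = 1) (he : e₀ * e₃ = -(e₁ * e₂)) :
    ‖(p : ℂ) * (e₀ + e₃) + (q : ℂ) * (e₁ + e₂)‖ ≤ 2 * √(p ^ 2 + q ^ 2) := by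
  have k₀ := mul_conj_of_norm_eq_one h₀
  have k₁ := mul_conj_of_norm_eq_one h₁
  have k₂ := mul_conj_of_norm_eq_one h₂
  have k₃ := mul_conj_of_norm_eq_one h₃
  have hX : e₀ + e₃ = star (e₀ + e₃) * (e₀ * e₃) := by
    rw [star_add]
    linear_combination -e₃ * k₀ - e₀ * k₃
  have hY : e₁ + e₂ = star (e₁ + e₂) * (e₁ * e₂) := by
    rw [star_add]
    linear_combination -e₂ * k₁ - e₁ * k₂
  have nX : ‖e₀ + e₃‖ ≤ 2 := (norm_add_le _ _).trans (by rw [h₀, h₃]; norm_num)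
  have nY : ‖e₁ + e₂‖ ≤ 2 := (norm_add_le _ _).trans (by rw [h₁, h₂]; norm_num)
  generalize e₀ + e₃ = X at *
  generalize e₁ + e₂ = Y at *
  have hXY : X * star Y = -(star X * Y) := by
    linear_combination star Y * hX - (-star X) * hY + star X * star Y * he
  have hre : (X * star Y).re = 0 := by
    have h := congrArg Complex.re hXY
    simp only [Complex.star_def, Complex.mul_re, Complex.neg_re, Complex.conj_re,
      Complex.conj_im] at h ⊢
    linarith
  apply abs_le_of_sq_le_sq' _ (by positivity) |>.2
  rw [mul_pow, Real.sq_sqrt (by positivity), ← Complex.normSq_eq_norm_sq, Complex.normSq_add]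
  have hcross : ((p : ℂ) * X * (starRingEnd ℂ) ((q : ℂ) * Y)).re = 0 := by
    have : (p : ℂ) * X * (starRingEnd ℂ) ((q : ℂ) * Y) = ((p * q : ℝ) : ℂ) * (X * star Y) := by
      rw [map_mul, Complex.conj_ofReal, Complex.star_def]
      push_cast
      ring
    rw [this, Complex.re_ofReal_mul, hre, mul_zero]
  rw [hcross, Complex.normSq_mul, Complex.normSq_mul, Complex.normSq_ofReal,
    Complex.normSq_ofReal, Complex.normSq_eq_norm_sq, Complex.normSq_eq_norm_sq]
  have nX2 : ‖X‖ ^ 2 ≤ 4 := by nlinarith [norm_nonneg X]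
  have nY2 : ‖Y‖ ^ 2 ≤ 4 := by nlinarith [norm_nonneg Y]
  nlinarith [mul_le_mul_of_nonneg_left nX2 (sq_nonneg p),
    mul_le_mul_of_nonneg_left nY2 (sq_nonneg q)]

/-! ### Test functionals -/

theorem exists_phase_shift (φ : ℝ) : ∃ δ : ℝ,
    Complex.exp (((φ + 4 * δ : ℝ) : ℂ) * Complex.I) = -1 ∧
    Real.cos δ ^ 2 = (1 + |Real.sin (φ / 2)|) / 2 := by
  -- Both `4 * δ = ±π - φ` give the first property; the sign is chosen so that `cos (2 * δ) = |sin
  -- (φ / 2)|`.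
  rcases le_total 0 (Real.sin (φ / 2)) with h | h
  · refine ⟨(Real.pi - φ) / 4, ?_, ?_⟩
    · rw [show φ + 4 * ((Real.pi - φ) / 4) = Real.pi by ring, Complex.exp_pi_mul_I]
    · rw [abs_of_nonneg h, Real.cos_sq, show 2 * ((Real.pi - φ) / 4) = Real.pi / 2 - φ / 2 by ring,
        Real.cos_pi_div_two_sub]
      ring
  · refine ⟨(-Real.pi - φ) / 4, ?_, ?_⟩
    · rw [show φ + 4 * ((-Real.pi - φ) / 4) = -Real.pi by ring, Complex.ofReal_neg, neg_mul,
        Complex.exp_neg, Complex.exp_pi_mul_I]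
      norm_num
    · rw [abs_of_nonpos h, Real.cos_sq,
        show 2 * ((-Real.pi - φ) / 4) = -(φ / 2 + Real.pi / 2) by ring, Real.cos_neg,
        Real.cos_add_pi_div_two]
      ring

theorem AntidiagBound.weighted_sum_sq_le {σ : Matrix (Fin 8) (Fin 8) ℂ} {r : ℝ}
    (hσ : AntidiagBound σ r) {θ : Fin 4 → ℝ} (hθ : IsPhases (upperAntidiag σ) θ)
    (s : Fin 4 → ℝ) (K : ℝ) (hK : ∀ e : Fin 4 → ℂ, (∀ i, ‖e i‖ = 1) →
      e 0 * e 3 = -(e 1 * e 2) → ‖∑ i, (s i : ℂ) * e i‖ ≤ K) :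
    (1 + |Real.sin (phaseDifference θ / 2)|) / 2 * (∑ i, s i * ‖upperAntidiag σ i‖) ^ 2 ≤
      (K * r) ^ 2 := by
  obtain ⟨δ, hδ, hcos⟩ := exists_phase_shift (phaseDifference θ)
  -- These signs change the phase difference by `4 * δ`, while each term loses only the factor `cos
  -- δ`.
  let η : Fin 4 → ℝ := ![δ, -δ, -δ, δ]
  let w : Fin 4 → ℂ := fun i => s i * Complex.exp (((-(θ i + η i) : ℝ) : ℂ) * Complex.I)
  have hw : ∀ u, IsProductPhase u → ‖∑ i, w i * u i‖ ≤ K := by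
    rintro u ⟨hu, hu'⟩
    have := hK (fun i => Complex.exp (((-(θ i + η i) : ℝ) : ℂ) * Complex.I) * u i) (fun i => by
      rw [norm_mul, Complex.norm_exp_ofReal_mul_I, hu, one_mul]) (by
      have h2 : Complex.exp (((-(θ 1 + η 1) : ℝ) : ℂ) * Complex.I) *
          Complex.exp (((-(θ 2 + η 2) : ℝ) : ℂ) * Complex.I) =
          Complex.exp (((phaseDifference θ + 4 * δ : ℝ) : ℂ) * Complex.I) *
          (Complex.exp (((-(θ 0 + η 0) : ℝ) : ℂ) * Complex.I) *
          Complex.exp (((-(θ 3 + η 3) : ℝ) : ℂ) * Complex.I)) := by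
        rw [← Complex.exp_add, ← Complex.exp_add, ← Complex.exp_add]
        congr 1
        simp only [η, phaseDifference, Matrix.cons_val]
        push_cast
        ring
      rw [hδ] at h2
      linear_combination (Complex.exp (((-(θ 0 + η 0) : ℝ) : ℂ) * Complex.I) *
          Complex.exp (((-(θ 3 + η 3) : ℝ) : ℂ) * Complex.I)) * hu' + u 1 * u 2 * h2)
    simpa only [w, mul_assoc] using this
  have hsum : (∑ i, w i * upperAntidiag σ i).re =
      Real.cos δ * ∑ i, s i * ‖upperAntidiag σ i‖ := by
    rw [Complex.re_sum, Finset.mul_sum]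
    refine Finset.sum_congr rfl fun i _ => ?_
    have h1 : w i * upperAntidiag σ i =
        ((s i * ‖upperAntidiag σ i‖ : ℝ) : ℂ) * Complex.exp (((-η i : ℝ) : ℂ) * Complex.I) := by
      have h2 : Complex.exp (((-(θ i + η i) : ℝ) : ℂ) * Complex.I) *
          Complex.exp ((θ i : ℂ) * Complex.I) = Complex.exp (((-η i : ℝ) : ℂ) * Complex.I) := by
        rw [← Complex.exp_add]
        congr 1
        push_cast
        ring
      rw [← h2]
      conv_lhs => rw [hθ i]
      simp only [w]
      push_cast
      ring
    have h3 : Real.cos (-η i) = Real.cos δ := by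
      fin_cases i <;> simp [η]
    rw [h1, Complex.re_ofReal_mul, Complex.exp_ofReal_mul_I_re, h3, mul_comm]
  have hle := (Complex.abs_re_le_norm _).trans (hσ.dual_le w K hw)
  rw [hsum] at hle
  rw [← hcos, ← mul_pow]
  exact sq_le_sq' (by linarith [neg_abs_le (Real.cos δ * ∑ i, s i * ‖upperAntidiag σ i‖)])
    ((le_abs_self _).trans hle)

theorem pair_weights_bound {σ : Matrix (Fin 8) (Fin 8) ℂ} {r : ℝ}
    (hσ : AntidiagBound σ r) {θ : Fin 4 → ℝ} (hθ : IsPhases (upperAntidiag σ) θ)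
    (s : Fin 4 → ℝ) {p q : ℝ} (hs : ∑ i, s i * ‖upperAntidiag σ i‖ = 2 * (p ^ 2 + q ^ 2))
    (hK : ∀ e : Fin 4 → ℂ, (∀ i, ‖e i‖ = 1) →
      e 0 * e 3 = -(e 1 * e 2) → ‖∑ i, (s i : ℂ) * e i‖ ≤ 2 * √(p ^ 2 + q ^ 2)) :
    (p ^ 2 + q ^ 2) * (1 + |Real.sin (phaseDifference θ / 2)|) ≤ 2 * r ^ 2 := by
  have h := hσ.weighted_sum_sq_le hθ s _ hK
  rw [hs, mul_pow, mul_pow, mul_pow, Real.sq_sqrt (by positivity)] at h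
  rcases (by positivity : 0 ≤ p ^ 2 + q ^ 2).eq_or_lt with h0 | h0
  · rw [← h0, zero_mul]
    positivity
  · refine le_of_mul_le_mul_left ?_ h0
    nlinarith

theorem AntidiagBound.pair_means_le {σ : Matrix (Fin 8) (Fin 8) ℂ} {r : ℝ}
    (hσ : AntidiagBound σ r) {θ : Fin 4 → ℝ} (hθ : IsPhases (upperAntidiag σ) θ)
    {i₁ i₂ i₃ i₄ : Fin 4} (hpart : ({i₁, i₂} ∪ {i₃, i₄} : Finset (Fin 4)) = Finset.univ)
    {p q : ℝ} (hp : p = (‖upperAntidiag σ i₁‖ + ‖upperAntidiag σ i₂‖) / 2)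
    (hq : q = (‖upperAntidiag σ i₃‖ + ‖upperAntidiag σ i₄‖) / 2) :
    (p ^ 2 + q ^ 2) * (1 + |Real.sin (phaseDifference θ / 2)|) ≤ 2 * r ^ 2 := by
  set n : Fin 4 → ℝ := fun i => ‖upperAntidiag σ i‖ with hn
  have h01 : ∀ p q : ℝ, 2 * p = n 0 + n 1 → 2 * q = n 2 + n 3 →
      (p ^ 2 + q ^ 2) * (1 + |Real.sin (phaseDifference θ / 2)|) ≤ 2 * r ^ 2 := by
    intro p q hp hq
    refine pair_weights_bound hσ hθ ![p, p, q, q] ?_ fun e he he' => ?_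
    · simp only [Fin.sum_univ_four, Matrix.cons_val]
      linear_combination -p * hp - q * hq
    · convert norm_combination_le_of_adjacent p q (he 0) (he 1) (he 2) (he 3) he' using 2
      simp only [Fin.sum_univ_four, Matrix.cons_val]
      ring
  have h02 : ∀ p q : ℝ, 2 * p = n 0 + n 2 → 2 * q = n 1 + n 3 →
      (p ^ 2 + q ^ 2) * (1 + |Real.sin (phaseDifference θ / 2)|) ≤ 2 * r ^ 2 := by
    intro p q hp hq
    refine pair_weights_bound hσ hθ ![p, q, p, q] ?_ fun e he he' => ?_
    · simp only [Fin.sum_univ_four, Matrix.cons_val]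
      linear_combination -p * hp - q * hq
    · convert norm_combination_le_of_adjacent p q (he 0) (he 2) (he 1) (he 3)
        (he'.trans (by ring)) using 2
      simp only [Fin.sum_univ_four, Matrix.cons_val]
      ring
  have h03 : ∀ p q : ℝ, 2 * p = n 0 + n 3 → 2 * q = n 1 + n 2 →
      (p ^ 2 + q ^ 2) * (1 + |Real.sin (phaseDifference θ / 2)|) ≤ 2 * r ^ 2 := by
    intro p q hp hq
    refine pair_weights_bound hσ hθ ![p, q, q, p] ?_ fun e he he' => ?_
    · simp only [Fin.sum_univ_four, Matrix.cons_val]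
      linear_combination -p * hp - q * hq
    · convert norm_combination_le_of_opposite p q (he 0) (he 1) (he 2) (he 3) he' using 2
      simp only [Fin.sum_univ_four, Matrix.cons_val]
      ring
  have swap : (p ^ 2 + q ^ 2) = q ^ 2 + p ^ 2 := add_comm _ _
  -- Here `k` is the partner of index 0, which determines the pairing.
  have cases : ∀ i₁ i₂ i₃ i₄ : Fin 4, ({i₁, i₂} ∪ {i₃, i₄} : Finset (Fin 4)) = Finset.univ →
      ∃ k l m : Fin 4, (k = 1 ∧ l = 2 ∧ m = 3 ∨ k = 2 ∧ l = 1 ∧ m = 3 ∨ k = 3 ∧ l = 1 ∧ m = 2) ∧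
      (((i₁ = 0 ∧ i₂ = k ∨ i₁ = k ∧ i₂ = 0) ∧ (i₃ = l ∧ i₄ = m ∨ i₃ = m ∧ i₄ = l)) ∨
      ((i₃ = 0 ∧ i₄ = k ∨ i₃ = k ∧ i₄ = 0) ∧ (i₁ = l ∧ i₂ = m ∨ i₁ = m ∧ i₂ = l))) := by
    decide
  obtain ⟨k, l, m, hklm, h⟩ := cases i₁ i₂ i₃ i₄ hpart
  have main : ∀ p q : ℝ, 2 * p = n 0 + n k → 2 * q = n l + n m →
      (p ^ 2 + q ^ 2) * (1 + |Real.sin (phaseDifference θ / 2)|) ≤ 2 * r ^ 2 := by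
    rcases hklm with ⟨rfl, rfl, rfl⟩ | ⟨rfl, rfl, rfl⟩ | ⟨rfl, rfl, rfl⟩ <;> assumption
  replace hp : 2 * p = n i₁ + n i₂ := by rw [hp]; ring
  replace hq : 2 * q = n i₃ + n i₄ := by rw [hq]; ring
  have pair : ∀ {i j k l : Fin 4}, (i = k ∧ j = l ∨ i = l ∧ j = k) → n i + n j = n k + n l := by
    rintro i j k l (⟨rfl, rfl⟩ | ⟨rfl, rfl⟩)
    · rfl
    · exact add_comm _ _
  rcases h with ⟨h, h'⟩ | ⟨h, h'⟩
  · exact main p q (hp.trans (pair h)) (hq.trans (pair h'))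
  · rw [swap]
    exact main q p (hq.trans (pair h)) (hp.trans (pair h'))

/-! ### Comparison with `xDelta` -/

theorem mean_quotient_le {m₁ m₂ s r : ℝ} (hs : 0 ≤ s) (hr : 0 ≤ r)
    (h : (m₁ ^ 2 + m₂ ^ 2) * (1 + s) ≤ 2 * r ^ 2) :
    √2 * m₁ * m₂ / √(m₁ ^ 2 + m₂ ^ 2) * √(1 + s) ≤ r := by
  rcases (by positivity : 0 ≤ m₁ ^ 2 + m₂ ^ 2).eq_or_lt with h0 | h0
  -- Division by zero yields 0, matching the convention for vanishing means.
  · rw [← h0]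
    simpa using hr
  · rw [div_mul_eq_mul_div, div_le_iff₀ (Real.sqrt_pos.2 h0)]
    apply abs_le_of_sq_le_sq' _ (by positivity) |>.2
    rw [mul_pow, mul_pow, mul_pow, mul_pow, Real.sq_sqrt h0.le, Real.sq_sqrt (by norm_num),
      Real.sq_sqrt (by positivity)]
    have h1 := mul_le_mul_of_nonneg_left h h0.le
    have h2 : 0 ≤ (m₁ ^ 2 - m₂ ^ 2) ^ 2 * (1 + s) := by positivity
    linarith

theorem le_rpow_quarter {r x : ℝ} (hr : 0 ≤ r) (h : r ^ 4 ≤ x) : r ≤ x ^ (1 / 4 : ℝ) := by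
  have h1 := Real.rpow_le_rpow (by positivity) h (by norm_num : (0 : ℝ) ≤ 1 / 4)
  rwa [← Real.rpow_natCast, ← Real.rpow_mul hr,
    show ((4 : ℕ) : ℝ) * (1 / 4) = 1 by norm_num, Real.rpow_one] at h1

theorem AntidiagBound.le_xDelta {σ : Matrix (Fin 8) (Fin 8) ℂ} {r : ℝ}
    (hσ : AntidiagBound σ r) :
    r ≤ xDelta ![diagRe σ 0, diagRe σ 1, diagRe σ 2, diagRe σ 3]
      ![diagRe σ 7, diagRe σ 6, diagRe σ 5, diagRe σ 4] := by
  refine le_min (Finset.le_inf' _ _ fun i _ => Real.le_sqrt_of_sq_le ?_)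
    (le_min (le_rpow_quarter hσ.nonneg ?_) (le_rpow_quarter hσ.nonneg ?_))
  · fin_cases i
    · exact hσ.sq_le 0
    · exact hσ.sq_le 1
    · exact hσ.sq_le 2
    · exact hσ.sq_le 3
  · exact hσ.even_le.trans_eq (mul_assoc _ _ _).symm
  · exact hσ.odd_le.trans_eq (mul_assoc _ _ _).symm

theorem upperAntidiag_of_xPart {ρ : Matrix (Fin 8) (Fin 8) ℂ} {a b : Fin 4 → ℝ}
    {c : Fin 4 → ℂ} (hX : xPart ρ = xMatrix a b c) : upperAntidiag ρ = c := by
  funext i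
  fin_cases i
  · exact congrFun (congrFun hX 0) 7
  · exact congrFun (congrFun hX 1) 6
  · exact congrFun (congrFun hX 2) 5
  · exact congrFun (congrFun hX 3) 4

theorem diagRe_of_xPart {ρ : Matrix (Fin 8) (Fin 8) ℂ} {a b : Fin 4 → ℝ}
    {c : Fin 4 → ℂ} (hX : xPart ρ = xMatrix a b c) :
    ![diagRe ρ 0, diagRe ρ 1, diagRe ρ 2, diagRe ρ 3] = a ∧
      ![diagRe ρ 7, diagRe ρ 6, diagRe ρ 5, diagRe ρ 4] = b := by
  have h : ∀ k, diagRe ρ k = (xMatrix a b c k k).re := fun k => by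
    rw [← hX]
    simp [xPart, diagRe]
  constructor <;> funext i <;> fin_cases i <;> exact h _

theorem proposition5p2 (ρ : Matrix (Fin 8) (Fin 8) ℂ) (hρ : IsThreeQubitState ρ)
    (a b : Fin 4 → ℝ) (c : Fin 4 → ℂ) (hX : xPart ρ = xMatrix a b c)
    (hsep : IsSeparableState ρ)
    (θ : Fin 4 → ℝ) (hθ : IsPhases c θ)
    (i₁ i₂ i₃ i₄ : Fin 4) (hpart : ({i₁, i₂} ∪ {i₃, i₄} : Finset (Fin 4)) = Finset.univ)
    (m₁ m₂ : ℝ) (hm₁ : m₁ = (‖c i₁‖ + ‖c i₂‖) / 2) (hm₂ : m₂ = (‖c i₃‖ + ‖c i₄‖) / 2) :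
    Real.sqrt 2 * m₁ * m₂ / Real.sqrt (m₁ ^ 2 + m₂ ^ 2) *
        Real.sqrt (1 + |Real.sin (phaseDifference θ / 2)|) ≤ xDelta a b := by
  obtain ⟨r, hr⟩ := hsep.exists_antidiagBound
  obtain ⟨ha, hb⟩ := diagRe_of_xPart hX
  rw [← upperAntidiag_of_xPart hX] at hθ hm₁ hm₂
  have hΔ := hr.le_xDelta
  rw [ha, hb] at hΔ
  exact (mean_quotient_le (abs_nonneg _) hr.nonneg (hr.pair_means_le hθ hpart hm₁ hm₂)).trans hΔ
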